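/- **Definitions.** Let $\Phi$ be a topological space. A subset $X\subset\Phi$ can be brought to a subset $Y\subset\Phi$ via a homotopy if there is a continuous map $H:X\times[0,1]\to\Phi$ with $H(x,0)=x$ for all $x\in X$ and $H(X\times\{1\})\subset Y$. For a continuous function $f:\Phi\to\mathbb{R}$, a number $a\in\mathbb{R}$ is a homotopy significant eigenvalue of $f$ if $\{x\in\Phi : f(x)\le a\}$ cannot be brought to $\{x\in\Phi : f(x)<a\}$ via a homotopy. A Morse function is a smooth real-valued function all of whose critical points are nondegenerate. **Lemma.** Let $M$ be a (finite-dimensional, Hausdorff, second countable) smooth manifold without boundary and let $f:M\to\mathbb{R}$ be a continuous function with a homotopy significant eigenvalue $e\in\mathbb{R}$. Let $F:M\to\mathbb{R}$ be a Morse function and let $\delta>0$ be such that $\sup_{x\in M}|f(x)-F(x)|<\delta$. Suppose that $F^{-1}([e-\delta,e+\delta])$ is compact (for instance, that $M$ is compact). Then $F$ has a homotopy significant eigenvalue $\widetilde e$ with $|e-\widetilde e|\le\delta$. -/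

import Mathlib

open scoped Manifold ContDiff

/-- In the space `Φ`, the subset `X` can be brought to the subset `Y` by a homotopy: there is a
homotopy of maps `X → Φ`, with values anywhere in `Φ`, that starts at the inclusion of `X` and
ends at a map with image in `Y`. -/
def CanBeBrought {Φ : Type*} [TopologicalSpace Φ] (X Y : Set Φ) : Prop :=
  ∃ H : C(X × unitInterval, Φ), (∀ x : X, H (x, 0) = x) ∧ ∀ x : X, H (x, 1) ∈ Y

/-- `a` is a homotopy significant eigenvalue of `f : Φ → ℝ`: the sublevel `{f ≤ a}` cannot be
brought, by a homotopy in `Φ`, to the strict sublevel `{f < a}`. -/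
def IsHomotopySignificant {Φ : Type*} [TopologicalSpace Φ] (f : Φ → ℝ) (a : ℝ) : Prop :=
  ¬ CanBeBrought {x | f x ≤ a} {x | f x < a}

section Morse

variable {n : ℕ} {M : Type*} [TopologicalSpace M] [ChartedSpace (EuclideanSpace ℝ (Fin n)) M]

/-- `p` is a critical point of `F`: the differential of `F` vanishes at `p`
(to be used for differentiable `F`). -/
def IsCriticalPoint (F : M → ℝ) (p : M) : Prop :=
  mfderiv (𝓡 n) 𝓘(ℝ, ℝ) F p = 0

/-- The Hessian of `F` at `p`: the second derivative at (the image of) `p` of `F` read in the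
preferred chart at `p`. At a critical point, its nondegeneracy does not depend on the chart. -/
noncomputable def chartHessian (F : M → ℝ) (p : M) :
    EuclideanSpace ℝ (Fin n) →L[ℝ] EuclideanSpace ℝ (Fin n) →L[ℝ] ℝ :=
  fderiv ℝ (fderiv ℝ (F ∘ (extChartAt (𝓡 n) p).symm)) (extChartAt (𝓡 n) p p)

/-- `F` is a Morse function: it is smooth and its Hessian is nondegenerate at each of its
critical points. -/
def IsMorseFunction (n : ℕ) {M : Type*} [TopologicalSpace M]
    [ChartedSpace (EuclideanSpace ℝ (Fin n)) M] (F : M → ℝ) : Prop :=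
  ContMDiff (𝓡 n) 𝓘(ℝ, ℝ) ∞ F ∧
    ∀ p : M, IsCriticalPoint (n := n) F p →
      ∀ v : EuclideanSpace ℝ (Fin n), (∀ w, chartHessian (n := n) F p v w = 0) → v = 0

end Morse

/-! Suppose no level in `[e - δ, e + δ]` is significant for `F`, and pick `d < δ` above the sup
distance. Since `{f ≤ e} ⊆ {F ≤ e + d}` and `{F ≤ e - d} ⊆ {f < e}`, it is enough to bring `{F ≤ e +
d}` to `{F ≤ e - d}`.

By `canBeBrought_of_locally`, a supremum argument, each level `c` need only be crossed from `c + ε`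
to `c - ε`. The assumption brings `{F ≤ c}` to `{F < c}`, and both sides get thickened. Above `c`,
the homotopy extends to `{F ≤ c + η}`, because maps from compact sets to a manifold extend to
neighbourhoods (`CanBeBrought.exists_pos_add`). Below `c`, critical values do not accumulate at `c`,
so iterated gradient descent brings `{F < c}` to some `{F ≤ b}` with `b < c`
(`IsMorseFunction.exists_canBeBrought_lt`). Nondegeneracy of critical points is used only there. -/

open Set Topology

/-! ### Formal properties of bringing one set to another. -/

section BringingSublevels

variable {Φ : Type*} [TopologicalSpace Φ]

theorem CanBeBrought.mono {X X' Y Y' : Set Φ} (h : CanBeBrought X Y) (hX : X' ⊆ X)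
    (hY : Y ⊆ Y') : CanBeBrought X' Y' := by
  obtain ⟨H, H0, H1⟩ := h
  refine ⟨H.comp ⟨fun p => (inclusion hX p.1, p.2), by fun_prop⟩, fun x => ?_, fun x => ?_⟩
  · exact H0 (inclusion hX x)
  · exact hY (H1 (inclusion hX x))

theorem canBeBrought_iff_homotopic {X Y : Set Φ} :
    CanBeBrought X Y ↔
      ∃ g : C(X, Φ), (⟨Subtype.val, continuous_subtype_val⟩ : C(X, Φ)).Homotopic g ∧
        ∀ x, g x ∈ Y := by
  constructor
  · rintro ⟨H, H0, H1⟩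
    exact ⟨⟨fun x => H (x, 1), by fun_prop⟩,
      ⟨{ toFun := fun p => H (p.2, p.1)
         continuous_toFun := by fun_prop
         map_zero_left := H0
         map_one_left := fun _ => rfl }⟩, H1⟩
  · rintro ⟨g, ⟨H⟩, hg⟩
    refine ⟨⟨fun p => H (p.2, p.1), by fun_prop⟩, fun x => H.map_zero_left x, fun x => ?_⟩
    have := hg x
    rwa [← H.map_one_left x] at this

theorem CanBeBrought.trans {X Y Z : Set Φ} (h : CanBeBrought X Y) (h' : CanBeBrought Y Z) :
    CanBeBrought X Z := by
  rw [canBeBrought_iff_homotopic] at *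
  obtain ⟨g, hg, hgY⟩ := h
  obtain ⟨g', hg', hgZ⟩ := h'
  let k : C(X, Y) := ⟨fun x => ⟨g x, hgY x⟩, by fun_prop⟩
  exact ⟨g'.comp k, hg.trans (hg'.comp (.refl k)), fun x => hgZ _⟩

/-- A homotopy defined on all of `Φ` need only be continuous over `X`. -/
theorem canBeBrought_iff_continuousOn {X Y : Set Φ} :
    CanBeBrought X Y ↔
      ∃ G : Φ × unitInterval → Φ, ContinuousOn G (X ×ˢ univ) ∧ (∀ x ∈ X, G (x, 0) = x) ∧
        ∀ x ∈ X, G (x, 1) ∈ Y := by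
  classical
  constructor
  · rintro ⟨H, H0, H1⟩
    refine ⟨fun p => if h : p.1 ∈ X then H (⟨p.1, h⟩, p.2) else p.1, ?_, fun x hx => ?_,
      fun x hx => ?_⟩
    · rw [continuousOn_iff_continuous_domRestrict]
      have : Continuous fun p : X ×ˢ (univ : Set unitInterval) =>
          H (⟨p.1.1, p.2.1⟩, p.1.2) := by fun_prop
      refine this.congr fun p => ?_
      simp only [domRestrict_apply]
      rw [dif_pos p.2.1]
    · simpa [hx] using H0 ⟨x, hx⟩
    · simpa [hx] using H1 ⟨x, hx⟩
  · rintro ⟨G, hG, G0, G1⟩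
    refine ⟨⟨fun p => G (p.1, p.2), ?_⟩, fun x => G0 x x.2, fun x => G1 x x.2⟩
    exact hG.comp_continuous (by fun_prop) fun p => ⟨p.1.2, mem_univ _⟩

end BringingSublevels

/-! ### Extending maps from compact sets into a manifold. -/

section NeighborhoodExtension

universe u v

variable {E : Type v} {M : Type*} {Z : Type u} [TopologicalSpace E] [TietzeExtension.{u, v} E]
  [TopologicalSpace M] [TopologicalSpace Z] [NormalSpace Z]

/-- A continuous map on a closed set `D` extends to a neighbourhood of each closed subset of `D`
that it maps into the domain of one chart. -/
theorem ContinuousOn.exists_extension_of_mapsTo_source {D B : Set Z} {h : Z → M}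
    (hD : IsClosed D) (hh : ContinuousOn h D) (hB : IsClosed B) (hBD : B ⊆ D)
    (c : OpenPartialHomeomorph M E) (hBc : MapsTo h B c.source) :
    ∃ D' : Set Z, IsClosed D' ∧ D ⊆ D' ∧ D' ∈ 𝓝ˢ B ∧
      ∃ h' : Z → M, ContinuousOn h' D' ∧ EqOn h' h D := by
  classical
  obtain ⟨O, hO, hOD⟩ := continuousOn_iff'.1 hh c.source c.open_source
  have hBO : B ⊆ O := fun z hz =>
    (hOD.subset ⟨hBc hz, hBD hz⟩ : z ∈ O ∩ D).1
  obtain ⟨V, hV, hBV, hVO⟩ := normal_exists_closure_subset hB hO hBO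
  have hVc : ∀ z ∈ D ∩ closure V, h z ∈ c.source := fun z hz =>
    (hOD.superset ⟨hVO hz.2, hz.1⟩ : z ∈ h ⁻¹' c.source ∩ D).1
  have hcl : IsClosed (D ∩ closure V) := hD.inter isClosed_closure
  have hch : ContinuousOn (c ∘ h) (D ∩ closure V) :=
    c.continuousOn.comp (hh.mono inter_subset_left) hVc
  -- Tietze in the chart. `G` may leave `c.target`, so it is used only on a smaller neighbourhood
  -- `W` of `B`.
  obtain ⟨G, hG⟩ := ContinuousMap.exists_restrict_eq hcl
    ⟨_, continuousOn_iff_continuous_domRestrict.1 hch⟩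
  have hG' : ∀ z ∈ D ∩ closure V, G z = c (h z) := fun z hz =>
    congrArg (fun k => k ⟨z, hz⟩) hG
  have hBO2 : B ⊆ V ∩ G ⁻¹' c.target := fun z hz => by
    refine ⟨hBV hz, ?_⟩
    rw [mem_preimage, hG' z ⟨hBD hz, subset_closure (hBV hz)⟩]
    exact c.map_source (hBc hz)
  obtain ⟨W, hW, hBW, hWO⟩ := normal_exists_closure_subset hB
    (hV.inter (c.open_target.preimage G.continuous)) hBO2
  refine ⟨D ∪ closure W, hD.union isClosed_closure, subset_union_left, ?_,
    fun z => if z ∈ D then h z else c.symm (G z), ?_, fun z hz => if_pos hz⟩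
  · exact Filter.mem_of_superset (hW.mem_nhdsSet.2 hBW)
      (subset_closure.trans subset_union_right)
  · refine ContinuousOn.union_of_isClosed ?_ ?_ hD isClosed_closure
    · exact hh.congr fun z hz => if_pos hz
    · have : ContinuousOn (fun z => c.symm (G z)) (closure W) :=
        c.continuousOn_symm.comp G.continuous.continuousOn fun z hz => (hWO hz).2
      refine this.congr fun z hz => ?_
      by_cases hzD : z ∈ D
      · have hz' : z ∈ D ∩ closure V := ⟨hzD, subset_closure (hWO hz).1⟩
        simp only [if_pos hzD]
        rw [hG' z hz', c.left_inv (hVc z hz')]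
      · simp only [if_neg hzD]

variable (E) in
/-- A continuous map from a compact subset of a normal Hausdorff space to a manifold extends to
a neighbourhood. -/
theorem IsCompact.exists_continuousOn_nhdsSet_extension [ChartedSpace E M] [T2Space Z]
    {A : Set Z} (hA : IsCompact A) {g : Z → M} (hg : ContinuousOn g A) :
    ∃ N ∈ 𝓝ˢ A, ∃ g' : Z → M, ContinuousOn g' N ∧ EqOn g' g A := by
  -- Quantifying over every closed `D ⊇ A` and every extension `h` to `D` lets the compactness
  -- induction perform extensions one after another, with no gluing of independent ones.
  have key : ∀ D h, IsClosed D → A ⊆ D → ContinuousOn h D → EqOn h g A →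
      ∃ D' : Set Z, IsClosed D' ∧ D ⊆ D' ∧ D' ∈ 𝓝ˢ A ∧
        ∃ h' : Z → M, ContinuousOn h' D' ∧ EqOn h' h D := by
    refine hA.induction_on (p := fun B => ∀ D h, IsClosed D → A ⊆ D → ContinuousOn h D →
      EqOn h g A → ∃ D' : Set Z, IsClosed D' ∧ D ⊆ D' ∧ D' ∈ 𝓝ˢ B ∧
        ∃ h' : Z → M, ContinuousOn h' D' ∧ EqOn h' h D) ?_ ?_ ?_ ?_
    · exact fun D h hD _ hh _ => ⟨D, hD, Subset.rfl, by simp, h, hh, fun _ _ => rfl⟩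
    · intro s t hst ht D h hD hAD hh hgh
      obtain ⟨D', h1, h2, h3, h4⟩ := ht D h hD hAD hh hgh
      exact ⟨D', h1, h2, nhdsSet_mono hst h3, h4⟩
    · intro s t hs ht D h hD hAD hh hgh
      obtain ⟨D', h1, h2, h3, h', h4, h5⟩ := hs D h hD hAD hh hgh
      obtain ⟨D'', k1, k2, k3, h'', k4, k5⟩ := ht D' h' h1 (hAD.trans h2) h4
        fun z hz => (h5 (hAD hz)).trans (hgh hz)
      refine ⟨D'', k1, h2.trans k2, ?_, h'', k4, fun z hz => (k5 (h2 hz)).trans (h5 hz)⟩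
      rw [nhdsSet_union]
      exact ⟨Filter.mem_of_superset h3 k2, k3⟩
    · intro z hz
      have h1 : g ⁻¹' (chartAt E (g z)).source ∈ 𝓝[A] z :=
        hg z hz ((chartAt E (g z)).open_source.mem_nhds (mem_chart_source E (g z)))
      obtain ⟨u, hu, hut⟩ := mem_nhdsWithin_iff_exists_mem_nhds_inter.1 h1
      obtain ⟨v, ⟨hv, hvcl⟩, hvu⟩ := (closed_nhds_basis z).mem_iff.1 hu
      refine ⟨v ∩ A, Filter.inter_mem (mem_nhdsWithin_of_mem_nhds hv) self_mem_nhdsWithin, ?_⟩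
      intro D h hD hAD hh hgh
      refine hh.exists_extension_of_mapsTo_source hD (hvcl.inter hA.isClosed)
        (inter_subset_right.trans hAD) (chartAt E (g z)) fun y hy => ?_
      rw [hgh hy.2]
      exact hut ⟨hvu hy.1, hy.2⟩
  obtain ⟨D', -, -, h3, h', h4, h5⟩ := key A g hA.isClosed Subset.rfl hg fun _ _ => rfl
  exact ⟨D', h3, h', h4, h5⟩

end NeighborhoodExtension

/-! ### Thickening a homotopy above a level. -/

section AboveLevel

universe u v

variable {M : Type u} [TopologicalSpace M]

/-- On the compact part of the slab outside `U`, `F` attains a minimum, which exceeds `a`; any level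
strictly between the two will do. -/
theorem exists_slab_subset_of_isCompact {F : M → ℝ} (hF : Continuous F) {a ε : ℝ} (hε : 0 < ε)
    (hC : IsCompact (F ⁻¹' Icc a (a + ε))) {U : Set M} (hU : IsOpen U) (hUa : F ⁻¹' {a} ⊆ U) :
    ∃ η > 0, η ≤ ε ∧ F ⁻¹' Icc a (a + η) ⊆ U := by
  rcases (F ⁻¹' Icc a (a + ε) \ U).eq_empty_or_nonempty with h | h
  · exact ⟨ε, hε, le_rfl, sdiff_eq_empty.1 h⟩
  · obtain ⟨x, hx, hmin⟩ := (hC.diff hU).exists_isMinOn h hF.continuousOn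
    have hax : a < F x := lt_of_le_of_ne hx.1.1 fun h => hx.2 (hUa h.symm)
    refine ⟨min ε ((F x - a) / 2), lt_min hε (by linarith), min_le_left _ _, fun y hy => ?_⟩
    by_contra hyU
    have h1 := min_le_left ε ((F x - a) / 2)
    have h2 := min_le_right ε ((F x - a) / 2)
    have hy2 : F y ≤ _ := hy.2
    have : F x ≤ F y := hmin ⟨⟨hy.1, by linarith⟩, hyU⟩
    linarith

/-- If `{F ≤ a}` can be brought to `{F < a}`, then so can a slightly larger sublevel, provided that
`F` is proper just above `a`. -/
theorem CanBeBrought.exists_pos_add (E : Type v) [TopologicalSpace E] [TietzeExtension.{u, v} E]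
    [ChartedSpace E M] [T2Space M] [NormalSpace (M × unitInterval)] {F : M → ℝ}
    (hF : Continuous F) {a ε : ℝ} (hε : 0 < ε) (hC : IsCompact (F ⁻¹' Icc a (a + ε)))
    (h : CanBeBrought {x | F x ≤ a} {x | F x < a}) :
    ∃ η > 0, CanBeBrought {x | F x ≤ a + η} {x | F x < a} := by
  classical
  obtain ⟨H, hH, H0, H1⟩ := canBeBrought_iff_continuousOn.1 h
  have hK : IsCompact (F ⁻¹' {a}) :=
    hC.of_isClosed_subset (isClosed_singleton.preimage hF) fun x (hx : F x = a) =>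
      ⟨hx.ge, by rw [hx]; linarith⟩
  set K : Set (M × unitInterval) := (F ⁻¹' {a}) ×ˢ univ
  -- Including the time-zero face over the slab forces the extended homotopy to start at the
  -- identity there.
  set B : Set (M × unitInterval) := (F ⁻¹' Icc a (a + ε)) ×ˢ {0}
  have hKc : IsCompact K := hK.prod isCompact_univ
  have hBc : IsCompact B := hC.prod isCompact_singleton
  let g : M × unitInterval → M := fun p => if F p.1 ≤ a then H p else p.1
  have hgX : ContinuousOn g ({x | F x ≤ a} ×ˢ univ) := hH.congr fun p hp => if_pos hp.1
  have hgA : ContinuousOn g (K ∪ B) := by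
    refine ContinuousOn.union_of_isClosed ?_ ?_ hKc.isClosed hBc.isClosed
    · exact hgX.mono fun p hp => ⟨(show F p.1 = a from hp.1).le, mem_univ _⟩
    · refine continuousOn_fst.congr fun p hp => ?_
      obtain ⟨x, t⟩ := p
      obtain rfl : t = 0 := hp.2
      by_cases hx : F x ≤ a
      · simp only [g, if_pos hx]; exact H0 x hx
      · simp only [g, if_neg hx]
  obtain ⟨N, hN, g', hg', hgg'⟩ :=
    (hKc.union hBc).exists_continuousOn_nhdsSet_extension E hgA
  obtain ⟨N', hN'o, hKN, hN'N⟩ := mem_nhdsSet_iff_exists.1 hN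
  obtain ⟨u, v, hu, -, hKu, hv, huv⟩ := generalized_tube_lemma hK
    (isCompact_univ (X := unitInterval)) hN'o (subset_union_left.trans hKN)
  have huN : u ×ˢ univ ⊆ N := fun p hp => hN'N (huv ⟨hp.1, hv hp.2⟩)
  have hcont : ContinuousOn (fun x => F (g' (x, 1))) u :=
    hF.comp_continuousOn (hg'.comp (by fun_prop) fun x hx => huN ⟨hx, mem_univ _⟩)
  -- The thin slab must lie in the tube where `g'` is continuous and must end strictly below `a`.
  obtain ⟨η, hη, hηε, hηu⟩ := exists_slab_subset_of_isCompact hF hε hC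
    (hcont.isOpen_inter_preimage hu (isOpen_Iio (a := a))) (by
      intro x hx
      refine ⟨hKu hx, ?_⟩
      have hxa : F x ≤ a := (show F x = a from hx).le
      have : g' (x, 1) = g (x, 1) := hgg' (Or.inl ⟨hx, mem_univ _⟩)
      rw [mem_preimage, this]
      simp only [g, if_pos hxa]
      exact H1 x hxa)
  refine ⟨η, hη, canBeBrought_iff_continuousOn.2
    ⟨fun p => if F p.1 ≤ a then g p else g' p, ?_, fun x hx => ?_, fun x hx => ?_⟩⟩
  · have hcl1 : IsClosed ({x | F x ≤ a} ×ˢ (univ : Set unitInterval)) :=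
      (isClosed_le hF continuous_const).prod isClosed_univ
    have hcl2 : IsClosed ((F ⁻¹' Icc a (a + η)) ×ˢ (univ : Set unitInterval)) :=
      (isClosed_Icc.preimage hF).prod isClosed_univ
    refine (ContinuousOn.union_of_isClosed
      (hgX.congr fun p hp => if_pos hp.1) ?_ hcl1 hcl2).mono ?_
    · refine (hg'.mono fun p hp => huN ⟨(hηu hp.1).1, mem_univ _⟩).congr fun p hp => ?_
      by_cases hpa : F p.1 ≤ a
      · exact (if_pos hpa).trans (hgg' (Or.inl ⟨le_antisymm hpa hp.1.1, mem_univ _⟩)).symm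
      · exact if_neg hpa
    · rintro p ⟨hp, -⟩
      rcases le_total (F p.1) a with h | h
      · exact Or.inl ⟨h, mem_univ _⟩
      · exact Or.inr ⟨⟨h, hp⟩, mem_univ _⟩
  · by_cases hxa : F x ≤ a
    · simp only [g, if_pos hxa]; exact H0 x hxa
    · have hx0 : (x, (0 : unitInterval)) ∈ K ∪ B :=
        Or.inr ⟨⟨(not_le.1 hxa).le, le_trans hx (by linarith)⟩, rfl⟩
      simp only [if_neg hxa, hgg' hx0, g]
  · by_cases hxa : F x ≤ a
    · simp only [g, if_pos hxa]; exact H1 x hxa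
    · simp only [if_neg hxa]
      exact (hηu ⟨(not_le.1 hxa).le, hx⟩).2

end AboveLevel

/-! ### Iterating a descent homotopy. -/

section Iteration

variable {X : Type*}

/-- The homotopy `P` run `k` times in succession, the `i`-th time during `[i, i + 1]`. -/
noncomputable def iterateHomotopy (P : X → unitInterval → X) : ℕ → X → ℝ → X
  | 0, x, _ => x
  -- The clamp keeps stage `k` at its start until time `k` and at its end after time `k + 1`.
  | k + 1, x, t => P (iterateHomotopy P k x t) (projIcc 0 1 zero_le_one (t - k))

variable {P : X → unitInterval → X}

theorem iterateHomotopy_eq_of_le (hP0 : ∀ x, P x 0 = x) {k l : ℕ} (hkl : k ≤ l) {x : X} {t : ℝ}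
    (ht : t ≤ k) : iterateHomotopy P l x t = iterateHomotopy P k x t := by
  induction l, hkl using Nat.le_induction with
  | base => rfl
  | succ l hl ih =>
    have : t - l ≤ 0 := by
      have : (k : ℝ) ≤ l := by exact_mod_cast hl
      linarith
    rw [iterateHomotopy, projIcc_of_le_left _ this, ih]
    exact hP0 _

theorem iterateHomotopy_eq_iterate {k : ℕ} {x : X} {t : ℝ} (ht : k ≤ t) :
    iterateHomotopy P k x t = (fun y => P y 1)^[k] x := by
  induction k with
  | zero => rfl
  | succ k ih =>
    push_cast at ht
    rw [iterateHomotopy, projIcc_of_right_le _ (by linarith), ih (by linarith),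
      Function.iterate_succ_apply']
    rfl

theorem antitone_comp_iterateHomotopy {F : X → ℝ} (hPF : ∀ x t, F (P x t) ≤ F x) (x : X) (t : ℝ) :
    Antitone fun k => F (iterateHomotopy P k x t) :=
  antitone_nat_of_succ_le fun _ => hPF _ _

variable [TopologicalSpace X]

theorem continuous_iterateHomotopy (hP : Continuous fun p : X × unitInterval => P p.1 p.2) (k : ℕ) :
    Continuous fun p : X × ℝ => iterateHomotopy P k p.1 p.2 := by
  induction k with
  | zero => exact continuous_fst
  | succ k ih =>
    have : Continuous fun p : X × ℝ => projIcc (0 : ℝ) 1 zero_le_one (p.2 - k) :=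
      continuous_projIcc.comp (by fun_prop)
    exact hP.comp (ih.prodMk this)

/-- Stages that have not begun act as the identity, so near `t` the varying number of stages can be
replaced by a fixed `N > t`. -/
theorem continuous_iterateHomotopy_ceil (hP : Continuous fun p : X × unitInterval => P p.1 p.2)
    (hP0 : ∀ x, P x 0 = x) :
    Continuous fun p : X × ℝ => iterateHomotopy P ⌈p.2⌉₊ p.1 p.2 := by
  rw [continuous_iff_continuousAt]
  rintro ⟨x, t⟩
  obtain ⟨N, hN⟩ := exists_nat_gt t
  refine (continuous_iterateHomotopy hP N).continuousAt.congr ?_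
  filter_upwards [continuous_snd.continuousAt.eventually (gt_mem_nhds hN)] with p hp
  exact iterateHomotopy_eq_of_le hP0 (Nat.ceil_le.2 (le_of_lt hp)) (Nat.le_ceil _)

/-- If `P 1` strictly decreases `F` on the compact slab `b ≤ F ≤ c`, then some iterate
brings `{F ≤ c}` to `{F ≤ b}`. -/
theorem exists_iterate_le_of_isCompact {F : X → ℝ} (hF : Continuous F) {p : X → X}
    (hp : Continuous p) (hpF : ∀ x, F (p x) ≤ F x) {b c : ℝ}
    (hC : IsCompact (F ⁻¹' Icc b c)) (hlt : ∀ x ∈ F ⁻¹' Icc b c, F (p x) < F x) :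
    ∃ k : ℕ, ∀ x, F x ≤ c → F (p^[k] x) ≤ b := by
  -- Compactness makes the decrease uniform, so each iterate loses at least `η` until it reaches
  -- level `b`.
  obtain ⟨η, hη, hηx⟩ : ∃ η > 0, ∀ x ∈ F ⁻¹' Icc b c, η ≤ F x - F (p x) := by
    rcases (F ⁻¹' Icc b c).eq_empty_or_nonempty with h | h
    · exact ⟨1, one_pos, by simp [h]⟩
    · obtain ⟨x, hx, hmin⟩ := hC.exists_isMinOn h
        (f := fun x => F x - F (p x)) (by fun_prop)
      exact ⟨_, sub_pos.2 (hlt x hx), fun y hy => hmin hy⟩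
  have key : ∀ k : ℕ, ∀ x, F x ≤ c → F (p^[k] x) ≤ max b (c - k * η) := by
    intro k
    induction k with
    | zero => intro x hx; simp [hx]
    | succ k ih =>
      intro x hx
      have h := ih x hx
      rw [Function.iterate_succ_apply']
      set y := p^[k] x
      by_cases hy : F y ≤ b
      · exact le_max_of_le_left ((hpF y).trans hy)
      · have hy' : F y ≤ c - k * η := (le_max_iff.1 h).resolve_left hy
        have : (0 : ℝ) ≤ k * η := by positivity
        have := hηx y ⟨(not_le.1 hy).le, by linarith⟩
        refine le_max_of_le_right ?_
        push_cast
        linarith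
  obtain ⟨k, hk⟩ := exists_nat_gt ((c - b) / η)
  refine ⟨k, fun x hx => (key k x hx).trans (max_le le_rfl ?_)⟩
  rw [div_lt_iff₀ hη] at hk
  linarith

end Iteration

/-- Iterating a homotopy that strictly decreases `F` on `b ≤ F < a` brings `{F < a}` to
`{F ≤ b}`. -/
theorem canBeBrought_of_strictly_decreasing {X : Type*} [TopologicalSpace X] {F : X → ℝ}
    (hF : Continuous F) {P : X → unitInterval → X}
    (hP : Continuous fun p : X × unitInterval => P p.1 p.2) (hP0 : ∀ x, P x 0 = x)
    (hPF : ∀ x t, F (P x t) ≤ F x) {a b : ℝ} (hC : IsCompact (F ⁻¹' Icc b a))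
    (hlt : ∀ x ∈ F ⁻¹' Ico b a, F (P x 1) < F x) :
    CanBeBrought {x | F x < a} {x | F x ≤ b} := by
  -- `T c` holds the running times sufficient for `{F ≤ c}`. They may blow up as `c → a`, but `T c`
  -- is upward closed, hence convex, and a constant choice works locally; a partition of unity then
  -- yields a continuous `τ`.
  let T : Iio a → Set ℝ := fun c =>
    {s | ∃ k : ℕ, (k : ℝ) ≤ s ∧ ∀ x, F x ≤ c → F ((fun y => P y 1)^[k] x) ≤ b}
  obtain ⟨τ, hτ⟩ := exists_continuous_forall_mem_convex_of_local_const (t := T)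
    (fun c => by
      refine OrdConnected.convex ⟨?_⟩
      rintro s ⟨k, hk, hkx⟩ t - u hu
      exact ⟨k, hk.trans hu.1, hkx⟩)
    (fun c => by
      obtain ⟨d, hcd, hda⟩ := exists_between (mem_Iio.1 c.2)
      obtain ⟨k, hk⟩ := exists_iterate_le_of_isCompact (p := fun y => P y 1) (b := b) (c := d) hF
        (by fun_prop) (fun x => hPF x 1)
        (hC.of_isClosed_subset (isClosed_Icc.preimage hF)
          (preimage_mono (Icc_subset_Icc_right (le_of_lt hda))))
        (fun x hx => hlt x ⟨hx.1, hx.2.trans_lt hda⟩)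
      refine ⟨k, ?_⟩
      filter_upwards [continuous_subtype_val.continuousAt.eventually (gt_mem_nhds hcd)] with c' hc'
      exact ⟨k, le_rfl, fun x hx => hk x (hx.trans hc'.le)⟩)
  refine ⟨⟨fun p => iterateHomotopy P ⌈(p.2 : ℝ) * τ ⟨F p.1, p.1.2⟩⌉₊ p.1
    ((p.2 : ℝ) * τ ⟨F p.1, p.1.2⟩), ?_⟩, fun x => ?_, fun x => ?_⟩
  · exact (continuous_iterateHomotopy_ceil hP hP0).comp
      (f := fun p : {x | F x < a} × unitInterval =>
        ((p.1 : X), (p.2 : ℝ) * τ ⟨F p.1, p.1.2⟩)) (by fun_prop)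
  · simp [iterateHomotopy]
  · obtain ⟨k, hk, hkx⟩ := hτ ⟨F x, x.2⟩
    have h1 : k ≤ ⌈τ ⟨F x, x.2⟩⌉₊ := (Nat.cast_le (α := ℝ)).1 (hk.trans (Nat.le_ceil _))
    have h2 := antitone_comp_iterateHomotopy hPF x (τ ⟨F x, x.2⟩) h1
    simp only [iterateHomotopy_eq_iterate hk] at h2
    simpa using h2.trans (hkx x le_rfl)

/-! ### Gradient descent in a Euclidean ball. -/

section GradientPush

variable {E : Type*} [NormedAddCommGroup E] [InnerProductSpace ℝ E] [CompleteSpace E]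

/-- Along the step the derivative varies by at most `K * σ * ‖v‖`, so by the mean value inequality
`G` changes by at most `-σ * ‖v‖ ^ 2 * (1 - K * σ) < 0`. -/
theorem lt_of_gradient_step {G : E → ℝ} {z : E} {R : ℝ} {K : NNReal}
    (hG : ∀ y ∈ Metric.ball z R, DifferentiableAt ℝ G y)
    (hK : LipschitzOnWith K (fderiv ℝ G) (Metric.ball z R)) {y : E} (hy : y ∈ Metric.ball z R)
    (hy0 : gradient G y ≠ 0) {σ : ℝ} (hσ : 0 < σ) (hσK : K * σ < 1)
    (hyσ : y - σ • gradient G y ∈ Metric.ball z R) :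
    G (y - σ • gradient G y) < G y := by
  set v := gradient G y
  have hv : 0 < ‖v‖ := norm_pos_iff.2 hy0
  have hvv : fderiv ℝ G y v = ‖v‖ ^ 2 := by
    rw [← real_inner_self_eq_norm_sq, (hG y hy).hasGradientAt.hasFDerivAt.fderiv]
    rfl
  have hσv : ‖y - σ • v - y‖ = σ * ‖v‖ := by
    rw [sub_sub_cancel_left, norm_neg, norm_smul, Real.norm_of_nonneg hσ.le]
  have h := Convex.norm_image_sub_le_of_norm_fderiv_le' (𝕜 := ℝ) (f := G) (C := K * (σ * ‖v‖))
    (s := Metric.ball z R ∩ Metric.closedBall y (σ * ‖v‖)) (x := y) (y := y - σ • v)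
    (φ := fderiv ℝ G y) (fun w hw => hG w hw.1)
    (fun w hw => by
      rw [← dist_eq_norm]
      refine (hK.dist_le_mul w hw.1 y hy).trans ?_
      gcongr
      exact hw.2)
    ((convex_ball z R).inter (convex_closedBall y _))
    ⟨hy, Metric.mem_closedBall_self (by positivity)⟩
    ⟨hyσ, by rw [Metric.mem_closedBall, dist_eq_norm, hσv]⟩
  rw [hσv, sub_sub_cancel_left, map_neg, map_smul, hvv, Real.norm_eq_abs, smul_eq_mul] at h
  have h1 := (abs_le.1 h).2
  have h2 : 0 < σ * ‖v‖ ^ 2 * (1 - K * σ) := by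
    have : 0 < 1 - K * σ := by linarith
    positivity
  nlinarith

/-- A homotopy of the ball of radius `R` supported in the closed ball of radius `r < R`, moving
points against the gradient of `G`. -/
theorem exists_gradient_push {G : E → ℝ} {z : E} {r R : ℝ} (hr : 0 < r) (hrR : 2 * r < R)
    {K : NNReal} (hG : ∀ y ∈ Metric.ball z R, DifferentiableAt ℝ G y)
    (hK : LipschitzOnWith K (fderiv ℝ G) (Metric.ball z R)) :
    ∃ q : E → unitInterval → E,
      ContinuousOn (fun p : E × unitInterval => q p.1 p.2) (Metric.ball z R ×ˢ univ) ∧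
      (∀ y, q y 0 = y) ∧ (∀ y ∉ Metric.closedBall z r, ∀ t, q y t = y) ∧
      (∀ y ∈ Metric.ball z R, ∀ t, q y t ∈ Metric.ball z R) ∧
      (∀ y ∈ Metric.ball z R, ∀ t, q y t = y ∨ G (q y t) < G y) ∧
      ∀ y ∈ Metric.ball z r, fderiv ℝ G y ≠ 0 → G (q y 1) < G y := by
  have hR : 0 < R := by linarith
  have hzR : z ∈ Metric.ball z R := Metric.mem_ball_self hR
  have hrsub : Metric.closedBall z r ⊆ Metric.ball z R :=
    Metric.closedBall_subset_ball (by linarith)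
  set B : ℝ := ‖gradient G z‖ + K * r
  have hB0 : 0 ≤ B := by positivity
  have hgrad : ∀ y y', ‖gradient G y - gradient G y'‖ = ‖fderiv ℝ G y - fderiv ℝ G y'‖ := by
    intro y y'
    simp only [gradient, ← map_sub, LinearIsometryEquiv.norm_map]
  have hB : ∀ y ∈ Metric.closedBall z r, ‖gradient G y‖ ≤ B := by
    intro y hy
    have h1 := hK.dist_le_mul y (hrsub hy) z hzR
    rw [dist_eq_norm, ← hgrad] at h1
    have h2 : ‖gradient G y‖ ≤ ‖gradient G z‖ + ‖gradient G y - gradient G z‖ :=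
      norm_le_insert' _ _
    have h3 : (K : ℝ) * dist y z ≤ K * r := by gcongr; exact hy
    linarith
  -- This gives `s * B ≤ 1`, so points move at most `r` and stay in the ball of radius `2 * r < R`,
  -- and `K * (s * r) < 1`, as `lt_of_gradient_step` requires.
  set s : ℝ := 1 / (B + K * r + 1)
  have hden : 0 < B + K * r + 1 := by positivity
  have hs : 0 < s := by positivity
  have hsB : s * B ≤ 1 := by
    rw [one_div_mul_eq_div, div_le_one hden]
    have : 0 ≤ K * r := by positivity
    linarith
  have hsK : K * (s * r) < 1 := by
    rw [show K * (s * r) = s * (K * r) by ring, one_div_mul_eq_div, div_lt_one hden]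
    linarith
  let χ : E → ℝ := fun y => max 0 (r - dist y z)
  have hχ0 : ∀ y, 0 ≤ χ y := fun y => le_max_left _ _
  have hχr : ∀ y, χ y ≤ r := fun y => max_le hr.le (by linarith [dist_nonneg (x := y) (y := z)])
  let q : E → unitInterval → E := fun y t => y - ((t : ℝ) * (s * χ y)) • gradient G y
  have hq_eq : ∀ y ∉ Metric.closedBall z r, ∀ t, q y t = y := by
    intro y hy t
    have hχy : χ y = 0 := max_eq_left (by
      rw [Metric.mem_closedBall, not_le] at hy; linarith)
    simp [q, hχy]
  have hq_mem : ∀ y ∈ Metric.ball z R, ∀ t, q y t ∈ Metric.ball z R := by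
    intro y hy t
    by_cases hyr : y ∈ Metric.closedBall z r
    · rw [Metric.mem_ball]
      have h1 : dist (q y t) y ≤ r := by
        rw [dist_eq_norm, sub_sub_cancel_left, norm_neg, norm_smul, Real.norm_of_nonneg
          (mul_nonneg t.2.1 (mul_nonneg hs.le (hχ0 y)))]
        calc (t : ℝ) * (s * χ y) * ‖gradient G y‖ ≤ 1 * (s * r) * B := by
              have := t.2.2
              have := hB y hyr
              have := hχr y
              have := hχ0 y
              gcongr
          _ = (s * B) * r := by ring
          _ ≤ 1 * r := by gcongr
          _ = r := one_mul r
      have h2 := dist_triangle (q y t) y z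
      have h3 : dist y z ≤ r := hyr
      linarith
    · rw [hq_eq y hyr]; exact hy
  have hq_lt : ∀ y ∈ Metric.ball z R, ∀ t : unitInterval, 0 < (t : ℝ) → 0 < χ y →
      gradient G y ≠ 0 → G (q y t) < G y := by
    intro y hy t ht hχ hv
    refine lt_of_gradient_step hG hK hy hv (by positivity) ?_ (hq_mem y hy t)
    refine lt_of_le_of_lt ?_ hsK
    have := t.2.2
    have := hχr y
    calc (K : ℝ) * (t * (s * χ y)) ≤ K * (1 * (s * r)) := by gcongr
      _ = K * (s * r) := by ring
  refine ⟨q, ?_, fun y => by simp [q], hq_eq, hq_mem, fun y hy t => ?_, fun y hy h => ?_⟩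
  · have hgc : ContinuousOn (gradient G) (Metric.ball z R) :=
      (InnerProductSpace.toDual ℝ E).symm.continuous.comp_continuousOn hK.continuousOn
    have hgc' : ContinuousOn (fun p : E × unitInterval => gradient G p.1)
        (Metric.ball z R ×ˢ univ) := hgc.comp continuousOn_fst fun p hp => hp.1
    have hc : Continuous fun p : E × unitInterval => (p.2 : ℝ) * (s * χ p.1) := by
      simp only [χ]; fun_prop
    exact continuousOn_fst.sub (hc.continuousOn.smul hgc')
  · by_cases ht : 0 < (t : ℝ)
    · by_cases hχ : 0 < χ y
      · by_cases hv : gradient G y = 0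
        · left; simp [q, hv]
        · exact Or.inr (hq_lt y hy t ht hχ hv)
      · left; simp [q, le_antisymm (not_lt.1 hχ) (hχ0 y)]
    · left; simp [q, le_antisymm (not_lt.1 ht) t.2.1]
  · refine hq_lt y (hrsub (Metric.ball_subset_closedBall hy)) 1 (by simp) ?_ ?_
    · exact lt_max_of_lt_right (sub_pos.2 hy)
    · simpa [gradient] using h

end GradientPush

/-! ### Isolation of critical points and critical values. -/

section CriticalPoints

variable {n : ℕ} {M : Type*} [TopologicalSpace M] [ChartedSpace (EuclideanSpace ℝ (Fin n)) M]
  [IsManifold (𝓡 n) ∞ M] {F : M → ℝ}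

theorem contDiffOn_comp_extChartAt_symm (hF : ContMDiff (𝓡 n) 𝓘(ℝ, ℝ) ∞ F) (p : M) :
    ContDiffOn ℝ ∞ (F ∘ (extChartAt (𝓡 n) p).symm) (extChartAt (𝓡 n) p).target :=
  contMDiffOn_iff_contDiffOn.1
    (hF.comp_contMDiffOn (contMDiffOn_extChartAt_symm p))

theorem contDiffAt_comp_extChartAt_symm (hF : ContMDiff (𝓡 n) 𝓘(ℝ, ℝ) ∞ F) (p : M)
    {y : EuclideanSpace ℝ (Fin n)} (hy : y ∈ (extChartAt (𝓡 n) p).target) :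
    ContDiffAt ℝ ∞ (F ∘ (extChartAt (𝓡 n) p).symm) y :=
  (contDiffOn_comp_extChartAt_symm hF p).contDiffAt ((isOpen_extChartAt_target p).mem_nhds hy)

theorem isCriticalPoint_iff_fderiv_eq_zero (hF : ContMDiff (𝓡 n) 𝓘(ℝ, ℝ) ∞ F) (p : M) {q : M}
    (hq : q ∈ (extChartAt (𝓡 n) p).source) :
    IsCriticalPoint (n := n) F q ↔
      fderiv ℝ (F ∘ (extChartAt (𝓡 n) p).symm) (extChartAt (𝓡 n) p q) = 0 := by
  have hy := (extChartAt (𝓡 n) p).map_source hq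
  have hinv := (extChartAt (𝓡 n) p).left_inv hq
  have hFd : ∀ x, MDifferentiableAt (𝓡 n) 𝓘(ℝ, ℝ) F x := fun x =>
    (hF x).mdifferentiableAt (by simp)
  have hsymm : MDifferentiableAt 𝓘(ℝ, EuclideanSpace ℝ (Fin n)) (𝓡 n)
      (extChartAt (𝓡 n) p).symm (extChartAt (𝓡 n) p q) :=
    ((contMDiffOn_extChartAt_symm (n := ∞) p).contMDiffAt
      ((isOpen_extChartAt_target p).mem_nhds hy)).mdifferentiableAt (by simp)
  have hchart : MDifferentiableAt (𝓡 n) 𝓘(ℝ, EuclideanSpace ℝ (Fin n))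
      (extChartAt (𝓡 n) p) q :=
    (contMDiffAt_extChartAt' (n := ∞) (by simpa using hq)).mdifferentiableAt (by simp)
  have hG : MDifferentiableAt 𝓘(ℝ, EuclideanSpace ℝ (Fin n)) 𝓘(ℝ, ℝ)
      (F ∘ (extChartAt (𝓡 n) p).symm) (extChartAt (𝓡 n) p q) :=
    (hFd _).comp _ hsymm
  unfold IsCriticalPoint
  constructor
  · intro h
    have h1 : mfderiv 𝓘(ℝ, EuclideanSpace ℝ (Fin n)) 𝓘(ℝ, ℝ)
        (F ∘ (extChartAt (𝓡 n) p).symm) (extChartAt (𝓡 n) p q) = _ :=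
      mfderiv_comp _ (hFd _) hsymm
    rw [hinv, h, mfderiv_eq_fderiv] at h1
    rw [h1]
    exact ContinuousLinearMap.zero_comp _
  · intro h
    have h1 : mfderiv (𝓡 n) 𝓘(ℝ, ℝ)
        ((F ∘ (extChartAt (𝓡 n) p).symm) ∘ extChartAt (𝓡 n) p) q = _ :=
      mfderiv_comp _ hG hchart
    rw [mfderiv_eq_fderiv, h] at h1
    have h2 : F =ᶠ[𝓝 q] (F ∘ (extChartAt (𝓡 n) p).symm) ∘ extChartAt (𝓡 n) p := by
      filter_upwards [extChartAt_source_mem_nhds' hq] with x hx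
      simp only [Function.comp, (extChartAt (𝓡 n) p).left_inv hx]
    rw [h2.mfderiv_eq, h1]
    exact ContinuousLinearMap.zero_comp _

/-- Every point has a neighbourhood that contains no critical point of a given Morse function,
except possibly the point itself. -/
theorem IsMorseFunction.eventually_not_isCriticalPoint (hF : IsMorseFunction n F) (p : M) :
    ∀ᶠ q in 𝓝[≠] p, ¬ IsCriticalPoint (n := n) F q := by
  set φ := extChartAt (𝓡 n) p
  set G := F ∘ φ.symm
  have hp : p ∈ φ.source := mem_extChartAt_source p
  have hG : ContDiffAt ℝ ∞ G (φ p) := contDiffAt_comp_extChartAt_symm hF.1 p (φ.map_source hp)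
  have hG' : ContDiffAt ℝ 1 (fderiv ℝ G) (φ p) := hG.fderiv_right (by norm_cast)
  -- At a critical point the Hessian is injective, hence bounded below in finite dimension, so the
  -- differential has an isolated zero; elsewhere continuity suffices.
  have hev : ∀ᶠ y in 𝓝[≠] (φ p), fderiv ℝ G y ≠ 0 := by
    by_cases hcrit : IsCriticalPoint (n := n) F p
    · have hd : HasFDerivAt (fderiv ℝ G) (chartHessian (n := n) F p) (φ p) :=
        (hG'.differentiableAt (by simp)).hasFDerivAt
      refine hd.eventually_ne ?_
      have hker : (chartHessian (n := n) F p).toLinearMap.ker = ⊥ := by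
        rw [LinearMap.ker_eq_bot']
        intro v hv
        exact hF.2 p hcrit v fun w => by
          have : chartHessian (n := n) F p v = 0 := hv
          rw [this]; rfl
      obtain ⟨K, -, hK⟩ := LinearMap.exists_antilipschitzWith _ hker
      exact ⟨K, hK⟩
    · rw [isCriticalPoint_iff_fderiv_eq_zero hF.1 p hp] at hcrit
      exact (hG'.continuousAt.eventually_ne hcrit).filter_mono nhdsWithin_le_nhds
  have htend : Filter.Tendsto φ (𝓝[≠] p) (𝓝[≠] (φ p)) := by
    refine tendsto_nhdsWithin_iff.2
      ⟨(continuousAt_extChartAt p).tendsto.mono_left nhdsWithin_le_nhds, ?_⟩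
    filter_upwards [self_mem_nhdsWithin,
      mem_nhdsWithin_of_mem_nhds (extChartAt_source_mem_nhds (I := 𝓡 n) p)] with q hq hqs h
    exact hq (φ.injOn hqs hp h)
  filter_upwards [htend.eventually hev,
    mem_nhdsWithin_of_mem_nhds (extChartAt_source_mem_nhds (I := 𝓡 n) p)] with q hq hqs
  rwa [isCriticalPoint_iff_fderiv_eq_zero hF.1 p hqs]

theorem IsMorseFunction.finite_isCriticalPoint (hF : IsMorseFunction n F) {C : Set M}
    (hC : IsCompact C) : {p ∈ C | IsCriticalPoint (n := n) F p}.Finite := by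
  refine hC.induction_on (p := fun s => {p ∈ s | IsCriticalPoint (n := n) F p}.Finite) ?_ ?_ ?_ ?_
  · simp
  · exact fun s t hst ht => ht.subset fun x hx => ⟨hst hx.1, hx.2⟩
  · intro s t hs ht
    refine (hs.union ht).subset ?_
    rintro x ⟨hx | hx, hx'⟩
    · exact Or.inl ⟨hx, hx'⟩
    · exact Or.inr ⟨hx, hx'⟩
  · intro p _
    have h := eventually_nhdsWithin_iff.1 (hF.eventually_not_isCriticalPoint p)
    refine ⟨_, mem_nhdsWithin_of_mem_nhds h, (finite_singleton p).subset ?_⟩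
    rintro q ⟨hq, hq'⟩
    by_contra hne
    exact hq hne hq'

/-- The critical values of a Morse function do not accumulate at a level near which it is
proper. -/
theorem IsMorseFunction.exists_forall_not_isCriticalPoint (hF : IsMorseFunction n F) {a b : ℝ}
    (hba : b < a) (hC : IsCompact (F ⁻¹' Icc b a)) :
    ∃ c ∈ Ico b a, ∀ x ∈ F ⁻¹' Ico c a, ¬ IsCriticalPoint (n := n) F x := by
  have hfin := (hF.finite_isCriticalPoint hC).image F
  -- The level `a` may itself be critical; the remaining critical values are finite in number and
  -- stay away from it.
  have hclosed : IsClosed (F '' {p ∈ F ⁻¹' Icc b a | IsCriticalPoint (n := n) F p} \ {a}) :=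
    (hfin.subset sdiff_subset).isClosed
  have hnhds := hclosed.isOpen_compl.mem_nhds
    (show a ∈ (F '' {p ∈ F ⁻¹' Icc b a | IsCriticalPoint (n := n) F p} \ {a})ᶜ from
      fun h => h.2 rfl)
  obtain ⟨l, hl, hlsub⟩ := exists_Ioc_subset_of_mem_nhds hnhds ⟨b, hba⟩
  obtain ⟨c, hc, hca⟩ := exists_between (max_lt hl hba)
  refine ⟨c, ⟨(le_max_right l b).trans hc.le, hca⟩, fun x hx hcrit => ?_⟩
  refine hlsub ⟨((le_max_left l b).trans_lt hc).trans_le hx.1, hx.2.le⟩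
    ⟨⟨x, ⟨⟨?_, hx.2.le⟩, hcrit⟩, rfl⟩, hx.2.ne⟩
  exact ((le_max_right l b).trans hc.le).trans hx.1

end CriticalPoints

/-! ### Descent homotopies on the manifold. -/

section ManifoldPush

variable {n : ℕ} {M : Type*} [TopologicalSpace M] [ChartedSpace (EuclideanSpace ℝ (Fin n)) M]
  [IsManifold (𝓡 n) ∞ M] [T2Space M] {F : M → ℝ}

/-- The Euclidean push is transported by the chart and extended by the identity. Its support lies in
`C`, compact and hence closed in the Hausdorff space `M`, so the two formulas glue. -/
theorem exists_push_near (hF : ContMDiff (𝓡 n) 𝓘(ℝ, ℝ) ∞ F) (p : M) :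
    ∃ P : M → unitInterval → M, Continuous (fun x : M × unitInterval => P x.1 x.2) ∧
      (∀ x, P x 0 = x) ∧ (∀ x t, P x t = x ∨ F (P x t) < F x) ∧
      ∀ᶠ x in 𝓝 p, ¬ IsCriticalPoint (n := n) F x → F (P x 1) < F x := by
  classical
  set φ := extChartAt (𝓡 n) p
  set G := F ∘ φ.symm
  have hp : p ∈ φ.source := mem_extChartAt_source p
  have hφp : φ p ∈ φ.target := φ.map_source hp
  have hG : ∀ y ∈ φ.target, ContDiffAt ℝ ∞ G y := fun y hy =>
    contDiffAt_comp_extChartAt_symm hF p hy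
  have hG' : ContDiffAt ℝ 1 (fderiv ℝ G) (φ p) := (hG _ hφp).fderiv_right (by norm_cast)
  obtain ⟨K, t, ht, hK⟩ := hG'.exists_lipschitzOnWith
  obtain ⟨R, hR, hRt⟩ := Metric.mem_nhds_iff.1
    (Filter.inter_mem ht ((isOpen_extChartAt_target (I := 𝓡 n) p).mem_nhds hφp))
  have hRT : Metric.ball (φ p) R ⊆ φ.target := fun y hy => (hRt hy).2
  have hr : 0 < R / 3 := by positivity
  obtain ⟨q, hqc, hq0, hqid, hqR, hqle, hqlt⟩ := exists_gradient_push (G := G) (z := φ p) hr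
    (by linarith : 2 * (R / 3) < R)
    (fun y hy => (hG y (hRT hy)).differentiableAt (by simp)) (hK.mono fun y hy => (hRt hy).1)
  have hrR : Metric.closedBall (φ p) (R / 3) ⊆ Metric.ball (φ p) R :=
    Metric.closedBall_subset_ball (by linarith)
  let W : Set M := φ.source ∩ φ ⁻¹' Metric.ball (φ p) R
  have hW : IsOpen W := (continuousOn_extChartAt p).isOpen_inter_preimage
    (isOpen_extChartAt_source p) Metric.isOpen_ball
  let C : Set M := φ.symm '' Metric.closedBall (φ p) (R / 3)
  have hC : IsClosed C := ((isCompact_closedBall _ _).image_of_continuousOn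
    ((continuousOn_extChartAt_symm p).mono (hrR.trans hRT))).isClosed
  have hCW : C ⊆ W := by
    rintro _ ⟨y, hy, rfl⟩
    refine ⟨φ.map_target (hRT (hrR hy)), ?_⟩
    rw [mem_preimage, φ.right_inv (hRT (hrR hy))]
    exact hrR hy
  let P : M → unitInterval → M := fun x t => if x ∈ W then φ.symm (q (φ x) t) else x
  have hPW : ∀ x ∈ W, ∀ t, P x t = φ.symm (q (φ x) t) := fun x hx t => if_pos hx
  have hPC : ∀ x ∉ C, ∀ t, P x t = x := by
    intro x hx t
    by_cases hxW : x ∈ W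
    · rw [hPW x hxW, hqid _ (fun h => hx ⟨φ x, h, φ.left_inv hxW.1⟩), φ.left_inv hxW.1]
    · exact if_neg hxW
  have hGx : ∀ x ∈ W, G (φ x) = F x := fun x hx => by
    simp only [G, Function.comp, φ.left_inv hx.1]
  refine ⟨P, ?_, fun x => ?_, fun x t => ?_, ?_⟩
  · rw [continuous_iff_continuousAt]
    rintro ⟨x, t⟩
    by_cases hx : x ∈ C
    · have hWo : IsOpen (W ×ˢ (univ : Set unitInterval)) := hW.prod isOpen_univ
      have h1 : ContinuousOn (fun x : M × unitInterval => φ.symm (q (φ x.1) x.2))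
          (W ×ˢ univ) := by
        refine (continuousOn_extChartAt_symm p).comp
          (hqc.comp (f := fun x : M × unitInterval => (φ x.1, x.2)) ?_
            fun x hx => ⟨hx.1.2, mem_univ _⟩) fun x hx => hRT (hqR _ hx.1.2 _)
        exact ((continuousOn_extChartAt p).comp continuousOn_fst fun x hx => hx.1.1).prodMk
          continuousOn_snd
      exact (h1.congr fun x hx => hPW _ hx.1 _).continuousAt
        (hWo.mem_nhds ⟨hCW hx, mem_univ _⟩)
    · refine continuousAt_fst.congr ?_
      filter_upwards [continuous_fst.continuousAt.eventually (hC.isOpen_compl.mem_nhds hx)] with y hy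
      exact (hPC _ hy _).symm
  · by_cases hx : x ∈ W
    · rw [hPW x hx, hq0, φ.left_inv hx.1]
    · exact if_neg hx
  · by_cases hx : x ∈ W
    · rw [hPW x hx, ← hGx x hx]
      rcases hqle (φ x) hx.2 t with h | h
      · rw [h, φ.left_inv hx.1]; exact Or.inl rfl
      · exact Or.inr h
    · exact Or.inl (if_neg hx)
  · filter_upwards [extChartAt_source_mem_nhds (I := 𝓡 n) p,
      (continuousAt_extChartAt (I := 𝓡 n) p).eventually (Metric.ball_mem_nhds _ hr)]
      with x hxs hxr hcrit
    have hxW : x ∈ W := ⟨hxs, hrR (Metric.ball_subset_closedBall hxr)⟩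
    rw [isCriticalPoint_iff_fderiv_eq_zero hF p hxs] at hcrit
    rw [hPW x hxW, ← hGx x hxW]
    exact hqlt (φ x) hxr hcrit

/-- There is a homotopy starting at the identity along which `F` does not increase, and whose end
strictly decreases `F` at the noncritical points of a given compact set. -/
theorem exists_push (hF : ContMDiff (𝓡 n) 𝓘(ℝ, ℝ) ∞ F) {C : Set M} (hC : IsCompact C) :
    ∃ P : M → unitInterval → M, Continuous (fun x : M × unitInterval => P x.1 x.2) ∧
      (∀ x, P x 0 = x) ∧ (∀ x t, P x t = x ∨ F (P x t) < F x) ∧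
      ∀ x ∈ C, ¬ IsCriticalPoint (n := n) F x → F (P x 1) < F x := by
  refine hC.induction_on (p := fun C => ∃ P : M → unitInterval → M,
    Continuous (fun x : M × unitInterval => P x.1 x.2) ∧
      (∀ x, P x 0 = x) ∧ (∀ x t, P x t = x ∨ F (P x t) < F x) ∧
      ∀ x ∈ C, ¬ IsCriticalPoint (n := n) F x → F (P x 1) < F x) ?_ ?_ ?_ ?_
  · exact ⟨fun x _ => x, continuous_fst, fun _ => rfl, fun _ _ => Or.inl rfl, by simp⟩
  · rintro s t hst ⟨P, h1, h2, h3, h4⟩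
    exact ⟨P, h1, h2, h3, fun x hx => h4 x (hst hx)⟩
  · rintro s t ⟨P, h1, h2, h3, h4⟩ ⟨Q, k1, k2, k3, k4⟩
    have hQ : ∀ x t, F (Q x t) ≤ F x := fun x t => (k3 x t).elim (fun h => by rw [h]) le_of_lt
    refine ⟨fun x t => Q (P x t) t, k1.comp (h1.prodMk continuous_snd), fun x => by simp only [h2, k2],
      fun x t => ?_, fun x hx hcrit => ?_⟩
    · rcases h3 x t with h | h
      · simp only [h]; exact k3 x t
      · exact Or.inr ((hQ _ _).trans_lt h)
    -- Here the dichotomy "fixed or strictly lower" matters: if `P` fixes `x`, then `Q` acts at `x`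
    -- itself, not at another point of the same level, which could be critical.
    · rcases h3 x 1 with h | h
      · rcases hx with hx | hx
        · exact (hQ _ _).trans_lt (h4 x hx hcrit)
        · simp only [h]; exact k4 x hx hcrit
      · exact (hQ _ _).trans_lt h
  · intro p _
    obtain ⟨P, h1, h2, h3, h4⟩ := exists_push_near hF p
    exact ⟨_, mem_nhdsWithin_of_mem_nhds h4, P, h1, h2, h3, fun x hx => hx⟩

/-- An open sublevel set of a Morse function can be brought strictly below its level. -/
theorem IsMorseFunction.exists_canBeBrought_lt (hF : IsMorseFunction n F) {a b : ℝ}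
    (hba : b < a) (hC : IsCompact (F ⁻¹' Icc b a)) :
    ∃ c < a, CanBeBrought {x | F x < a} {x | F x ≤ c} := by
  obtain ⟨c, hc, hcrit⟩ := hF.exists_forall_not_isCriticalPoint hba hC
  have hC' : IsCompact (F ⁻¹' Icc c a) := hC.of_isClosed_subset
    (isClosed_Icc.preimage hF.1.continuous) (preimage_mono (Icc_subset_Icc_left hc.1))
  obtain ⟨P, hP, hP0, hPF, hPlt⟩ := exists_push hF.1 hC'
  exact ⟨c, hc.2, canBeBrought_of_strictly_decreasing hF.1.continuous hP hP0
    (fun x t => (hPF x t).elim (fun h => by rw [h]) le_of_lt) hC'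
    fun x hx => hPlt x ⟨hx.1, hx.2.le⟩ (hcrit x hx)⟩

end ManifoldPush

/-- If every level of `[a, b]` can locally be crossed downwards, so can the whole interval. -/
theorem canBeBrought_of_locally {X : Type*} [TopologicalSpace X] {F : X → ℝ} {a b : ℝ}
    (hab : a ≤ b)
    (h : ∀ c ∈ Icc a b, ∃ ε > 0, CanBeBrought {x | F x ≤ c + ε} {x | F x ≤ c - ε}) :
    CanBeBrought {x | F x ≤ b} {x | F x ≤ a} := by
  let S : Set ℝ := {c ∈ Icc a b | CanBeBrought {x | F x ≤ c} {x | F x ≤ a}}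
  have haS : a ∈ S := ⟨left_mem_Icc.2 hab, ⟨⟨fun p => p.1, by fun_prop⟩, fun x => rfl, fun x => x.2⟩⟩
  have hbdd : BddAbove S := ⟨b, fun c hc => hc.1.2⟩
  have hsup : sSup S ∈ Icc a b := ⟨le_csSup hbdd haS, csSup_le ⟨a, haS⟩ fun c hc => hc.1.2⟩
  obtain ⟨ε, hε, hεB⟩ := h (sSup S) hsup
  obtain ⟨c, hcS, hc⟩ := exists_lt_of_lt_csSup ⟨a, haS⟩ (sub_lt_self (sSup S) hε)
  have hB : CanBeBrought {x | F x ≤ sSup S + ε} {x | F x ≤ a} :=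
    (hεB.mono Subset.rfl fun x (hx : F x ≤ _) => hx.trans hc.le).trans hcS.2
  -- Either `b` is already reached, or `sSup S + ε` lies in `S`, which is absurd.
  rcases le_or_gt b (sSup S + ε) with hb | hb
  · exact hB.mono (fun x hx => le_trans hx hb) Subset.rfl
  · have := le_csSup hbdd (show sSup S + ε ∈ S from ⟨⟨by linarith [hsup.1], hb.le⟩, hB⟩)
    linarith

theorem mainTheorem10 {n : ℕ} {M : Type*} [TopologicalSpace M] [T2Space M]
    [SecondCountableTopology M] [ChartedSpace (EuclideanSpace ℝ (Fin n)) M]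
    [IsManifold (𝓡 n) ∞ M]
    (f : M → ℝ) (hf : Continuous f) (e : ℝ) (he : IsHomotopySignificant f e)
    (F : M → ℝ) (hF : IsMorseFunction n F)
    (δ : ℝ) (hδ : 0 < δ) (hfF : (⨆ x : M, ((|f x - F x| : ℝ) : EReal)) < (δ : EReal))
    (hcpt : IsCompact (F ⁻¹' Set.Icc (e - δ) (e + δ))) :
    ∃ e' : ℝ, IsHomotopySignificant F e' ∧ |e - e'| ≤ δ := by
  by_contra! hcon
  have hlevel : ∀ c ∈ Icc (e - δ) (e + δ), CanBeBrought {x | F x ≤ c} {x | F x < c} := by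
    intro c hc
    by_contra hnot
    exact absurd (abs_le.2 ⟨by linarith [hc.2], by linarith [hc.1]⟩) (not_le.2 (hcon c hnot))
  obtain ⟨d₀, hd₀, hd₀δ⟩ := EReal.lt_iff_exists_real_btwn.1 hfF
  -- `d < δ` leaves compact slabs on both sides of every level in `[e - d, e + d]`. The maximum with
  -- `0` covers empty `M`, where the supremum is `⊥`.
  obtain ⟨d, hd, hdδ⟩ := exists_between (max_lt (EReal.coe_lt_coe_iff.1 hd₀δ) hδ)
  have hd0 : 0 < d := (le_max_right _ _).trans_lt hd
  have hclose : ∀ x, |f x - F x| < d := fun x =>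
    (EReal.coe_lt_coe_iff.1 ((le_iSup (fun x : M => ((|f x - F x| : ℝ) : EReal)) x).trans_lt hd₀)).trans
      ((le_max_left _ _).trans_lt hd)
  -- Used to obtain normality of `M × unitInterval`, needed for Tietze extension.
  have hlc : LocallyCompactSpace M := ChartedSpace.locallyCompactSpace (EuclideanSpace ℝ (Fin n)) M
  have hFc := hF.1.continuous
  have hsub : ∀ {b c : ℝ}, e - δ ≤ b → c ≤ e + δ → IsCompact (F ⁻¹' Icc b c) := fun hb hc =>
    hcpt.of_isClosed_subset (isClosed_Icc.preimage hFc) (preimage_mono (Icc_subset_Icc hb hc))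
  refine he ((canBeBrought_of_locally (F := F) (a := e - d) (b := e + d) (by linarith)
    fun c hc => ?_).mono (fun x (hx : f x ≤ e) => ?_) fun x (hx : F x ≤ e - d) => ?_)
  · have hc' : c ∈ Icc (e - δ) (e + δ) := ⟨by linarith [hc.1], by linarith [hc.2]⟩
    obtain ⟨η, hη, hup⟩ := (hlevel c hc').exists_pos_add (EuclideanSpace ℝ (Fin n)) hFc
      (sub_pos.2 hdδ) (hsub hc'.1 (by linarith [hc.2]))
    obtain ⟨b, hb, hdown⟩ := hF.exists_canBeBrought_lt (a := c) (b := e - δ)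
      (by linarith [hc.1]) (hsub le_rfl hc'.2)
    refine ⟨min η (c - b), lt_min hη (sub_pos.2 hb), (hup.trans hdown).mono
      (fun x (hx : F x ≤ _) => hx.trans ?_) fun x (hx : F x ≤ b) => hx.trans ?_⟩
    · linarith [min_le_left η (c - b)]
    · linarith [min_le_right η (c - b)]
  · have := abs_lt.1 (hclose x)
    show F x ≤ e + d
    linarith
  · have := abs_lt.1 (hclose x)
    show f x < e
    linarith
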